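/- Let $\alpha=\{a_j\}_{j\ge 1}$ be a sequence of strictly positive real numbers and let $m\ge 1$ be an integer. Put $S_m(y)=\sum_{l=0}^{m-1}\frac{y^l}{l!}$, $A_N=\sum_{j=1}^N a_j$, and $$L_1(\alpha;m)=\int_0^1\Big\{1-\prod_{j=1}^\infty\big[1-x^{a_j}S_m(-a_j\ln x)\big]\Big\}\frac{dx}{x}\in(0,\infty].$$ For each integer $N\ge 1$, let coupons be drawn independently, each being of type $j\in\{1,\dots,N\}$ with probability $p_j=a_j/A_N$, and let $T_m(N)$ be the smallest number of draws after which every one of the $N$ types has been drawn at least $m$ times. Suppose that $L_1(\alpha;m)<\infty$. Then: (1) for every $s\in[0,\infty)$, $$P\left\{\frac{T_m(N)}{A_N}\le s\right\}\longrightarrow F_\alpha(s):=\prod_{j=1}^\infty\big[1-S_m(a_js)e^{-a_js}\big]\qquad\text{as }N\to\infty;$$ (2) $F_\alpha$ (extended by $0$ to $s<0$) is the distribution function of a probability measure on $\mathbb R$, and this measure is not a Gumbel law: for all $b\in\mathbb R$ and $c>0$ its distribution function differs from $x\mapsto\exp(-e^{-(x-b)/c})$; (3) the limit law depends on $\alpha$: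 there is another sequence $\alpha'$ of strictly positive numbers with $L_1(\alpha';m)<\infty$ and $F_{\alpha'}(s)\neq F_\alpha(s)$ for some $s\ge 0$. -/

import Mathlib

open Filter MeasureTheory ProbabilityTheory Set
open scoped Topology ENNReal

/-- The `m`-th partial sum `S_m(y) = ∑_{l=0}^{m-1} y^l / l!` of the exponential series. -/
noncomputable def expPartialSum (m : ℕ) (y : ℝ) : ℝ :=
  ∑ l ∈ Finset.range m, y ^ l / (Nat.factorial l : ℝ)

/-- `A_N`, the sum of the first `N` terms of the sequence. Sequences are indexed from `0`,
so that `a j` is the `(j+1)`-st term of the sequence. -/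
noncomputable def partialTotal (a : ℕ → ℝ) (N : ℕ) : ℝ :=
  ∑ j ∈ Finset.range N, a j

/-- The probability `p_j = a_j / A_N` of the coupon of type `j`, among `N` types. -/
noncomputable def couponProb (a : ℕ → ℝ) (N : ℕ) (j : Fin N) : ℝ :=
  a j / partialTotal a N

/-- `L₁(α; m) = ∫₀¹ (1 - ∏_{j ≥ 1} (1 - x^{a_j} S_m(-a_j ln x))) dx / x`, with values in `[0, ∞]`. -/
noncomputable def L1 (a : ℕ → ℝ) (m : ℕ) : ℝ≥0∞ :=
  ∫⁻ x in Ioo (0 : ℝ) 1,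
    ENNReal.ofReal ((1 - ∏' j, (1 - x ^ a j * expPartialSum m (-(a j) * Real.log x))) / x)

/-- `F(s) = ∏_{j ≥ 1} (1 - S_m(a_j s) e^{-a_j s})`, used for `s ≥ 0`. -/
noncomputable def limitF (a : ℕ → ℝ) (m : ℕ) (s : ℝ) : ℝ :=
  ∏' j, (1 - expPartialSum m (a j * s) * Real.exp (-(a j * s)))

/-- The Gumbel distribution function with location `b` and scale `c`. -/
noncomputable def gumbelCDF (b c x : ℝ) : ℝ :=
  Real.exp (-Real.exp (-((x - b) / c)))

/-- `X 0, X 1, …` are independent draws of a coupon, of type `i` with probability `p i`. -/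
structure IsCouponDraws {Ω : Type*} [MeasurableSpace Ω] {N : ℕ} (P : Measure Ω)
    (p : Fin N → ℝ) (X : ℕ → Ω → Fin N) : Prop where
  isProbabilityMeasure : IsProbabilityMeasure P
  measurable : ∀ k, Measurable (X k)
  indep : iIndepFun X P
  law : ∀ k i, P.real {ω | X k ω = i} = p i

/-- The number of coupons of type `i` among the first `n` draws. -/
def couponCount {Ω : Type*} {N : ℕ} (X : ℕ → Ω → Fin N) (n : ℕ) (i : Fin N) (ω : Ω) : ℕ :=
  ((Finset.range n).filter (fun k => X k ω = i)).card

/-- `T_m(N)`: the least number `n` of draws after which each of the `N` types has been drawn at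
least `m` times (`⊤` if this never happens). -/
noncomputable def collectTime {Ω : Type*} {N : ℕ} (m : ℕ) (X : ℕ → Ω → Fin N) (ω : Ω) : ℕ∞ :=
  ⨅ (n : ℕ) (_ : ∀ i, m ≤ couponCount X n i ω), (n : ℕ∞)

theorem expPartialSum_mul_exp_mem (m : ℕ) {y : ℝ} (hy : 0 ≤ y) :
    0 ≤ expPartialSum m y * Real.exp (-y) ∧ expPartialSum m y * Real.exp (-y) ≤ 1 := by
  have h0 : 0 ≤ expPartialSum m y := Finset.sum_nonneg fun l _ => by positivity
  refine ⟨by positivity, ?_⟩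
  rw [Real.exp_neg, mul_inv_le_iff₀ (Real.exp_pos y), one_mul]
  exact Real.sum_le_exp_of_nonneg hy m

/-- An infinite product of numbers in `[0, 1]` converges (to their infimum of finite products), so
that the infinite products used above are genuine. -/
theorem multipliable_of_mem_Icc {f : ℕ → ℝ} (hf : ∀ j, 0 ≤ f j ∧ f j ≤ 1) : Multipliable f := by
  refine ⟨⨅ t : Finset ℕ, ∏ j ∈ t, f j, ?_⟩
  refine tendsto_atTop_ciInf ?_ ⟨0, ?_⟩
  · intro s t hst
    exact Finset.prod_le_prod_of_subset_of_le_one hst (fun j _ => (hf j).1) (fun j _ _ => (hf j).2)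
  · rintro _ ⟨t, rfl⟩
    exact Finset.prod_nonneg fun j _ => (hf j).1

theorem multipliable_limitF {a : ℕ → ℝ} (ha : ∀ j, 0 < a j) (m : ℕ) {s : ℝ} (hs : 0 ≤ s) :
    Multipliable fun j => 1 - expPartialSum m (a j * s) * Real.exp (-(a j * s)) := by
  refine multipliable_of_mem_Icc fun j => ?_
  have h := expPartialSum_mul_exp_mem m (mul_nonneg (ha j).le hs)
  constructor <;> linarith [h.1, h.2]

theorem multipliable_L1 {a : ℕ → ℝ} (ha : ∀ j, 0 < a j) (m : ℕ) {x : ℝ} (hx : x ∈ Ioo (0 : ℝ) 1) :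
    Multipliable fun j => 1 - x ^ a j * expPartialSum m (-(a j) * Real.log x) := by
  have hs : 0 ≤ -Real.log x := by linarith [Real.log_neg hx.1 hx.2]
  refine (multipliable_limitF ha m hs).congr fun j => ?_
  rw [Real.rpow_def_of_pos hx.1, mul_comm (Real.exp _)]
  ring_nf

/-!
Let `φ(y) = S_m(y) e^{-y}`, the probability that a Poisson variable of mean `y` is below `m`, let
`F_N(t) = ∏_{j < N} (1 - φ(a_j t))` and let `G_N(n)` be the probability that `n` draws complete
the collection of `N` types.

*Poissonization.* If the number of draws is Poisson with mean `t A_N`, the counts of the `N` types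
are independent Poisson variables with means `a_j t`. As an identity between series this says that
the Poisson average of `G_N` is exactly `F_N(t)` (`hasSum_poissonWeight_mul_collected`). It follows
from the multinomial law of the counts, so no Poisson process has to be built on the given
probability spaces.

*De-Poissonization.* `G_N` is monotone with values in `[0, 1]`, so Chebyshev's inequality for the
Poisson law gives `G_N(⌊s A_N⌋) ≤ F_N(s + ε) + (s + ε) / (ε² A_N)` and
`F_N(s - ε) ≤ G_N(⌊s A_N⌋) + (s - ε) / (ε² A_N)` (`le_poisson_mean_add`, `poisson_mean_le_add`).
The choice `ε_N = A_N^{-1/3}` makes the errors vanish. Since `F` may jump at the edge of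
`{F = 0}` (as at `s = 1` for `m = 1` and `a_j = log j + 2 log log j` for large `j`), keeping `ε` fixed
while `N → ∞` would lose that point; hence the shrinking `ε_N`.

*Shrinking windows.* The bound `limsup F_N(s + ε_N) ≤ F(s)` holds because `F` is an infimum of
continuous functions (`eventually_finiteF_lt`). For `liminf F_N(s - ε_N) ≥ F(s)` one may assume
`F(s) > 0`, so that `∑ φ(a_j s)` converges. The types with `a_j ε_N ≤ 1` are handled by dominated
convergence, because `φ(y - h) ≤ e^h φ(y)`; for the others `φ(a_j s / 2)` is at most a constant
times `a_j⁻³ ≤ ε_N⁴ a_j`, and these bounds add up to `O(ε_N⁴ A_N) = O(ε_N)`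
(`eventually_lt_finiteF_sub`).

*Consequences of `L₁ < ∞`.* In the variable `s = -log x`, `L₁ = ∫ (1 - F(s)) ds`, so `F` is positive
somewhere (`exists_limitF_pos`). This gives `A_N → ∞` and `F(s) → 1` at infinity. As `F` is monotone,
right-continuous and `F(0) = 0`, it is a distribution function supported on `[0, ∞)`, whereas a
Gumbel distribution function is positive at `0`. Finally, doubling `a_0` alone increases `F`
wherever it is positive at some `s > 0`, and does not increase `L₁`.
-/

/-! ### Multinomial law of the counts and Poissonization -/

theorem MvPolynomial.prod_monomial {ι κ : Type*} (s : Finset κ) (e : κ → ι →₀ ℕ) (c : κ → ℝ) :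
    ∏ i ∈ s, MvPolynomial.monomial (e i) (c i) =
      MvPolynomial.monomial (∑ i ∈ s, e i) (∏ i ∈ s, c i) := by
  classical
  induction s using Finset.induction_on with
  | empty => rfl
  | insert i s hi ih =>
    rw [Finset.prod_insert hi, Finset.sum_insert hi, Finset.prod_insert hi, ih,
      MvPolynomial.monomial_mul]

/-- Grouping the words of length `n` by their letter counts. The multinomial theorem, applied to
polynomial variables weighted by `p`, does the counting; a linear functional then replaces each
monomial by the value of `Φ` at its exponents. -/
theorem sum_words_eq_sum_piAntidiag {ι : Type*} [Fintype ι] [DecidableEq ι] (p : ι → ℝ)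
    (Φ : (ι → ℕ) → ℝ) (n : ℕ) :
    ∑ w : Fin n → ι, (∏ i, p (w i)) * Φ (fun j => (Finset.univ.filter fun i => w i = j).card) =
      ∑ k ∈ Finset.piAntidiag Finset.univ n,
        (Nat.multinomial Finset.univ k : ℝ) * (∏ j, p j ^ k j) * Φ k := by
  classical
  -- the linear functional on polynomials that sends the monomial with exponents `k` to `Φ k`
  let L : MvPolynomial ι ℝ →ₗ[ℝ] ℝ :=
    (MvPolynomial.basisMonomials ι ℝ).constr ℝ fun k : ι →₀ ℕ => Φ k
  have hL : ∀ (k : ι →₀ ℕ) (c : ℝ), L (MvPolynomial.monomial k c) = c * Φ k := by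
    intro k c
    have h1 : MvPolynomial.monomial k c = c • MvPolynomial.basisMonomials ι ℝ k := by
      simp [MvPolynomial.smul_monomial]
    rw [h1, map_smul, Module.Basis.constr_basis, smul_eq_mul]
  have key := congrArg L ((Fintype.sum_pow (fun j => MvPolynomial.monomial
    (Finsupp.single j 1) (p j)) n).symm.trans (Finset.sum_pow_eq_sum_piAntidiag Finset.univ
      (fun j => MvPolynomial.monomial (Finsupp.single j 1) (p j)) n))
  rw [map_sum, map_sum] at key
  refine Eq.trans (Finset.sum_congr rfl fun w _ => ?_) (key.trans
    (Finset.sum_congr rfl fun k _ => ?_))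
  · have h := MvPolynomial.prod_monomial Finset.univ (fun i => Finsupp.single (w i) 1) fun i => p (w i)
    rw [h, hL]
    congr 2
    ext j
    simp [Finsupp.finsetSum_apply, Finsupp.single_apply]
  · rw [← nsmul_eq_mul, map_nsmul]
    simp_rw [MvPolynomial.monomial_pow]
    have h := MvPolynomial.prod_monomial Finset.univ (fun j => k j • Finsupp.single j 1) fun j => p j ^ k j
    rw [h, hL, nsmul_eq_mul, mul_assoc]
    congr 3
    ext j
    simp [Finsupp.finsetSum_apply, Finsupp.single_apply]

/-- The counts of the types among the first `n` draws have the multinomial law. -/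
theorem measureReal_couponCount_mem {Ω : Type*} [MeasurableSpace Ω] {N : ℕ} {P : Measure Ω}
    {p : Fin N → ℝ} {X : ℕ → Ω → Fin N} (hX : IsCouponDraws P p X) (n : ℕ)
    (S : Set (Fin N → ℕ)) :
    P.real {ω | (fun i => couponCount X n i ω) ∈ S} =
      ∑ k ∈ Finset.piAntidiag Finset.univ n,
        (Nat.multinomial Finset.univ k : ℝ) * (∏ j, p j ^ k j) * S.indicator 1 k := by
  classical
  have := hX.isProbabilityMeasure
  rw [← sum_words_eq_sum_piAntidiag]
  let W : Ω → Fin n → Fin N := fun ω i => X i ω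
  have hcount : ∀ ω i, couponCount X n i ω =
      (Finset.univ.filter fun k : Fin n => W ω k = i).card := by
    intro ω i
    rw [couponCount, Finset.card_filter, Finset.card_filter, ← Fin.sum_univ_eq_sum_range
      (fun k => if X k ω = i then 1 else 0)]
  let T : Finset (Fin n → Fin N) := Finset.univ.filter fun w =>
    (fun j => (Finset.univ.filter fun i => w i = j).card) ∈ S
  have hset : {ω | (fun i => couponCount X n i ω) ∈ S} = W ⁻¹' T := by
    ext ω
    simp [T, hcount]
  have hW : Measurable W := measurable_pi_lambda _ fun i => hX.measurable i
  have hlaw : ∀ w : Fin n → Fin N, P.real (W ⁻¹' {w}) = ∏ i, p (w i) := by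
    intro w
    have h1 : W ⁻¹' {w} = ⋂ i ∈ (Finset.univ : Finset (Fin n)), (X i) ⁻¹' {w i} := by
      ext ω
      simp [W, funext_iff]
    have hind : iIndepFun (fun i : Fin n => X i) P := hX.indep.precomp Fin.val_injective
    rw [h1, measureReal_def, hind.measure_inter_preimage_eq_mul _ (fun i _ => by measurability),
      ENNReal.toReal_prod]
    exact Finset.prod_congr rfl fun i _ => hX.law i (w i)
  rw [hset, ← sum_measureReal_preimage_singleton T (fun w _ => hW (measurableSet_singleton w)),
    Finset.sum_filter]
  refine Finset.sum_congr rfl fun w _ => ?_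
  simp only [Set.indicator_apply, Pi.one_apply, mul_ite, mul_one, mul_zero]
  rw [hlaw]

/-- A multinomial vector whose number of trials is Poisson with mean `r` has independent Poisson
coordinates with means `p j * r`; this is the resulting probability that all coordinates are at
least `m`. It is obtained by slicing a product of Poisson measures according to the total count. -/
theorem hasSum_poisson_multinomial {ι : Type*} [Fintype ι] [DecidableEq ι] {p : ι → ℝ}
    (hp : ∀ j, 0 ≤ p j) (hp1 : ∑ j, p j = 1) {r : ℝ} (hr : 0 ≤ r) (m : ℕ) :
    HasSum (fun n : ℕ => Real.exp (-r) * r ^ n / (n.factorial : ℝ) *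
      ∑ k ∈ Finset.piAntidiag Finset.univ n, (Nat.multinomial Finset.univ k : ℝ) *
        (∏ j, p j ^ k j) * ({k : ι → ℕ | ∀ j, m ≤ k j}).indicator 1 k)
      (∏ j, (1 - expPartialSum m (p j * r) * Real.exp (-(p j * r)))) := by
  classical
  let μ : Measure (ι → ℕ) := Measure.pi fun j => poissonMeasure (p j * r).toNNReal
  let E : Set (ι → ℕ) := {k | ∀ j, m ≤ k j}
  have hcoe : ∀ j, ((p j * r).toNNReal : ℝ) = p j * r := fun j =>
    Real.coe_toNNReal _ (mul_nonneg (hp j) hr)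
  have hE : μ.real E = ∏ j, (1 - expPartialSum m (p j * r) * Real.exp (-(p j * r))) := by
    have h1 : E = Set.pi univ fun _ => Ici m := by ext; simp [E, Pi.le_def]
    rw [h1, measureReal_def, Measure.pi_pi, ENNReal.toReal_prod]
    refine Finset.prod_congr rfl fun j _ => ?_
    have h2 : (Ici m : Set ℕ) = ((Finset.range m : Finset ℕ) : Set ℕ)ᶜ := by ext; simp
    rw [← measureReal_def, h2, probReal_compl_eq_one_sub (Finset.measurableSet _),
      ← sum_measureReal_singleton, expPartialSum, Finset.sum_mul]
    congr 1
    refine Finset.sum_congr rfl fun l _ => ?_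
    rw [poissonMeasure_real_singleton, hcoe]
    ring
  have hdisj : Pairwise (Function.onFun Disjoint
      fun n : ℕ => E ∩ {k : ι → ℕ | ∑ j, k j = n}) := by
    intro a b hab
    refine Set.disjoint_left.2 fun k hk hk' => hab ?_
    exact hk.2.symm.trans hk'.2
  have hU : (⋃ n : ℕ, E ∩ {k : ι → ℕ | ∑ j, k j = n}) = E := by ext; simp
  have hsum : HasSum (fun n : ℕ => μ.real (E ∩ {k : ι → ℕ | ∑ j, k j = n})) (μ.real E) := by
    have h := measure_iUnion (μ := μ) hdisj fun n => (MeasurableSet.of_discrete :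
      MeasurableSet (E ∩ {k : ι → ℕ | ∑ j, k j = n}))
    rw [hU] at h
    have h' := ENNReal.hasSum_toReal (h ▸ measure_ne_top μ E)
    rwa [← ENNReal.tsum_toReal_eq (fun n => measure_ne_top μ _), ← h] at h'
  rw [← hE]
  convert hsum using 2 with n
  have hset : E ∩ {k : ι → ℕ | ∑ j, k j = n} =
      (((Finset.piAntidiag Finset.univ n).filter (· ∈ E) : Finset (ι → ℕ)) : Set (ι → ℕ)) := by
    ext k
    simp [and_comm]
  rw [hset, ← sum_measureReal_singleton, Finset.sum_filter, Finset.mul_sum]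
  refine Finset.sum_congr rfl fun k hk => ?_
  have hkn : ∑ j, k j = n := by simpa using hk
  by_cases hkE : k ∈ E
  · rw [if_pos hkE, Set.indicator_of_mem hkE, Pi.one_apply, mul_one, measureReal_def,
      Measure.pi_singleton, ENNReal.toReal_prod]
    simp_rw [← measureReal_def, poissonMeasure_real_singleton, hcoe]
    have hmult : (Nat.multinomial Finset.univ k : ℝ) =
        (n.factorial : ℝ) / ∏ j, ((k j).factorial : ℝ) := by
      rw [eq_div_iff (by positivity), mul_comm, ← hkn]
      exact_mod_cast Nat.multinomial_spec Finset.univ k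
    have hexp : ∏ j, Real.exp (-(p j * r)) = Real.exp (-r) := by
      rw [← Real.exp_sum, Finset.sum_neg_distrib, ← Finset.sum_mul, hp1, one_mul]
    rw [hmult, Finset.prod_div_distrib, Finset.prod_mul_distrib, hexp]
    simp_rw [mul_pow]
    rw [Finset.prod_mul_distrib, Finset.prod_pow_eq_pow_sum, hkn]
    have : (n.factorial : ℝ) ≠ 0 := by positivity
    field_simp
  · rw [if_neg hkE, Set.indicator_of_notMem hkE, mul_zero, mul_zero]

/-! ### Poisson lower tail as a function of the mean -/

/-- The function `y ↦ S_m(y) e^{-y}`: the probability that a Poisson variable of mean `y` is smaller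
than `m`, or that an Erlang variable of shape `m` and rate `1` exceeds `y`. -/
noncomputable def erlangTail (m : ℕ) (y : ℝ) : ℝ := expPartialSum m y * Real.exp (-y)

theorem erlangTail_nonneg (m : ℕ) {y : ℝ} (hy : 0 ≤ y) : 0 ≤ erlangTail m y :=
  (expPartialSum_mul_exp_mem m hy).1

theorem erlangTail_le_one (m : ℕ) {y : ℝ} (hy : 0 ≤ y) : erlangTail m y ≤ 1 :=
  (expPartialSum_mul_exp_mem m hy).2

theorem expPartialSum_zero_right {m : ℕ} (hm : 1 ≤ m) : expPartialSum m 0 = 1 := by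
  obtain ⟨k, rfl⟩ : ∃ k, m = k + 1 := ⟨m - 1, by omega⟩
  simp [expPartialSum, Finset.sum_range_succ']

theorem erlangTail_zero_right {m : ℕ} (hm : 1 ≤ m) : erlangTail m 0 = 1 := by
  simp [erlangTail, expPartialSum_zero_right hm]

theorem expPartialSum_mono (m : ℕ) {x y : ℝ} (hx : 0 ≤ x) (hxy : x ≤ y) :
    expPartialSum m x ≤ expPartialSum m y :=
  Finset.sum_le_sum fun l _ => by gcongr

theorem hasDerivAt_expPartialSum (m : ℕ) (y : ℝ) :
    HasDerivAt (expPartialSum (m + 1)) (expPartialSum m y) y := by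
  have h : ∀ k, HasDerivAt (fun x => ∑ l ∈ Finset.range (k + 1), x ^ l / (l.factorial : ℝ))
      (∑ l ∈ Finset.range k, y ^ l / (l.factorial : ℝ)) y := by
    intro k
    induction k with
    | zero => simpa using hasDerivAt_const y (1 : ℝ)
    | succ k ih =>
      have h2 : HasDerivAt (fun x : ℝ => x ^ (k + 1) / ((k + 1).factorial : ℝ))
          (y ^ k / (k.factorial : ℝ)) y := by
        refine ((hasDerivAt_pow (k + 1) y).div_const _).congr_deriv ?_
        rw [Nat.factorial_succ]
        push_cast
        have : ((k : ℝ) + 1) ≠ 0 := by positivity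
        have : (k.factorial : ℝ) ≠ 0 := by positivity
        field_simp
      have h3 := ih.add h2
      rw [Finset.sum_range_succ _ k]
      refine h3.congr_of_eventuallyEq (Eventually.of_forall fun x => ?_)
      exact Finset.sum_range_succ _ (k + 1)
  exact h m

theorem hasDerivAt_erlangTail (m : ℕ) (y : ℝ) :
    HasDerivAt (erlangTail (m + 1)) (-(y ^ m / (m.factorial : ℝ) * Real.exp (-y))) y := by
  have h := (hasDerivAt_expPartialSum m y).mul (hasDerivAt_neg y).exp
  refine h.congr_deriv ?_
  have : expPartialSum (m + 1) y = expPartialSum m y + y ^ m / (m.factorial : ℝ) :=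
    Finset.sum_range_succ _ _
  rw [this]
  ring

@[fun_prop]
theorem continuous_erlangTail (m : ℕ) : Continuous (erlangTail m) := by
  unfold erlangTail expPartialSum
  fun_prop

theorem strictAntiOn_erlangTail {m : ℕ} (hm : 1 ≤ m) : StrictAntiOn (erlangTail m) (Ici 0) := by
  obtain ⟨k, rfl⟩ : ∃ k, m = k + 1 := ⟨m - 1, by omega⟩
  refine strictAntiOn_of_deriv_neg (convex_Ici 0) (continuous_erlangTail _).continuousOn ?_
  intro y hy
  rw [interior_Ici, mem_Ioi] at hy
  rw [(hasDerivAt_erlangTail k y).deriv, neg_lt_zero]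
  positivity

theorem erlangTail_anti {m : ℕ} (hm : 1 ≤ m) {x y : ℝ} (hx : 0 ≤ x) (hxy : x ≤ y) :
    erlangTail m y ≤ erlangTail m x :=
  (strictAntiOn_erlangTail hm).antitoneOn hx (hx.trans hxy : (0 : ℝ) ≤ y) hxy

/-- A decrease of the mean by `h` multiplies the Poisson lower tail by at most `e^h`; this is what
makes dominated convergence applicable when the time is perturbed. -/
theorem erlangTail_sub_le (m : ℕ) {y h : ℝ} (hh : 0 ≤ h) (hy : h ≤ y) :
    erlangTail m (y - h) ≤ Real.exp h * erlangTail m y := by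
  have h1 : Real.exp (-(y - h)) = Real.exp h * Real.exp (-y) := by rw [← Real.exp_add]; ring_nf
  have h2 := expPartialSum_mono m (sub_nonneg.2 hy) (sub_le_self y hh)
  rw [erlangTail, erlangTail, h1]
  calc expPartialSum m (y - h) * (Real.exp h * Real.exp (-y))
      ≤ expPartialSum m y * (Real.exp h * Real.exp (-y)) := by gcongr
    _ = _ := by ring

theorem tendsto_pow_mul_erlangTail (k m : ℕ) :
    Tendsto (fun y => y ^ k * erlangTail m y) atTop (𝓝 0) := by
  have h : ∀ l ∈ Finset.range m, Tendsto
      (fun y : ℝ => (1 / (l.factorial : ℝ)) * (y ^ (k + l) * Real.exp (-y))) atTop (𝓝 0) := by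
    intro l _
    simpa using (Real.tendsto_pow_mul_exp_neg_atTop_nhds_zero (k + l)).const_mul
      (1 / (l.factorial : ℝ))
  have h2 := tendsto_finsetSum _ h
  rw [Finset.sum_const_zero] at h2
  refine h2.congr fun y => ?_
  rw [erlangTail, expPartialSum, Finset.sum_mul, Finset.mul_sum]
  exact Finset.sum_congr rfl fun l _ => by ring

theorem tendsto_erlangTail_atTop (m : ℕ) : Tendsto (erlangTail m) atTop (𝓝 0) := by
  simpa using tendsto_pow_mul_erlangTail 0 m

theorem exists_erlangTail_le (k m : ℕ) :
    ∃ C : ℝ, 0 < C ∧ ∀ y, 0 < y → erlangTail m y ≤ C / y ^ k := by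
  obtain ⟨R, hR⟩ := eventually_atTop.1
    ((tendsto_pow_mul_erlangTail k m).eventually_le_const (zero_lt_one (α := ℝ)))
  refine ⟨1 + |R| ^ k, by positivity, fun y hy => ?_⟩
  rw [le_div_iff₀ (by positivity), mul_comm]
  rcases le_total R y with h | h
  · have := hR y h
    have : 0 ≤ |R| ^ k := by positivity
    linarith
  · have h1 : y ^ k ≤ |R| ^ k := pow_le_pow_left₀ hy.le (h.trans (le_abs_self R)) k
    have h2 : y ^ k * erlangTail m y ≤ |R| ^ k * 1 :=
      mul_le_mul h1 (erlangTail_le_one m hy.le) (erlangTail_nonneg m hy.le) (by positivity)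
    linarith

/-! ### Poisson concentration -/

/-- The mass at `n` of the Poisson distribution with mean `r`. -/
noncomputable def poissonWeight (r : ℝ) (n : ℕ) : ℝ := Real.exp (-r) * r ^ n / (n.factorial : ℝ)

theorem poissonWeight_nonneg {r : ℝ} (hr : 0 ≤ r) (n : ℕ) : 0 ≤ poissonWeight r n := by
  unfold poissonWeight; positivity

theorem hasSum_poissonWeight {r : ℝ} (hr : 0 ≤ r) : HasSum (poissonWeight r) 1 :=
  hasSum_one_poissonMeasure ⟨r, hr⟩

theorem poissonWeight_succ_mul (r : ℝ) (n : ℕ) :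
    poissonWeight r (n + 1) * ((n + 1 : ℕ) : ℝ) = r * poissonWeight r n := by
  unfold poissonWeight
  rw [Nat.factorial_succ]
  push_cast
  have : ((n : ℝ) + 1) ≠ 0 := by positivity
  have : (n.factorial : ℝ) ≠ 0 := by positivity
  field_simp
  ring

theorem hasSum_poissonWeight_mul_id {r : ℝ} (hr : 0 ≤ r) :
    HasSum (fun n : ℕ => poissonWeight r n * n) r := by
  have h := (hasSum_poissonWeight hr).mul_left r
  rw [mul_one] at h
  rw [← hasSum_nat_add_iff' 1]
  simp_rw [poissonWeight_succ_mul]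
  simpa using h

/-- The Poisson distribution with mean `r` has variance `r`. -/
theorem hasSum_poissonWeight_variance {r : ℝ} (hr : 0 ≤ r) :
    HasSum (fun n : ℕ => poissonWeight r n * ((n : ℝ) - r) ^ 2) r := by
  have h0 := hasSum_poissonWeight hr
  have h1 := hasSum_poissonWeight_mul_id hr
  have h2 : HasSum (fun n : ℕ => poissonWeight r n * (n : ℝ) ^ 2) (r * (r + 1)) := by
    have h := (h1.add h0).mul_left r
    rw [← hasSum_nat_add_iff' 1]
    have e : (fun n : ℕ => poissonWeight r (n + 1) * ((n + 1 : ℕ) : ℝ) ^ 2) =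
        fun n => r * (poissonWeight r n * n + poissonWeight r n) := by
      funext n
      have := poissonWeight_succ_mul r n
      push_cast at this ⊢
      linear_combination ((n : ℝ) + 1) * this
    rw [e]
    simpa using h
  have h := (h2.sub (h1.mul_left (2 * r))).add (h0.mul_left (r ^ 2))
  have e : r * (r + 1) - 2 * r * r + r ^ 2 * 1 = r := by ring
  rw [e] at h
  have e' : (fun n : ℕ => poissonWeight r n * ((n : ℝ) - r) ^ 2) = fun n : ℕ =>
      poissonWeight r n * (n : ℝ) ^ 2 - 2 * r * (poissonWeight r n * n) +
        r ^ 2 * poissonWeight r n := by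
    funext n; ring
  rwa [e']

/-- Chebyshev's inequality in the form used to remove the Poisson averaging: if `n` lies below the
mean `r` by at least `δ`, then `g n` exceeds the Poisson average of `g` by at most `r / δ²`. -/
theorem le_poisson_mean_add {g : ℕ → ℝ} (hg : Monotone g) (hg0 : ∀ n, 0 ≤ g n)
    (hg1 : ∀ n, g n ≤ 1) {r δ F : ℝ} (hr : 0 ≤ r) (hδ : 0 < δ)
    (hF : HasSum (fun n => poissonWeight r n * g n) F) {n : ℕ} (hn : n + δ ≤ r) :
    g n ≤ F + r / δ ^ 2 := by
  have h1 := (hasSum_poissonWeight hr).mul_right (g n)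
  have h2 := hF.add ((hasSum_poissonWeight_variance hr).mul_right (1 / δ ^ 2))
  have h3 := hasSum_le (fun k => ?_) h1 h2
  · rw [one_mul] at h3
    calc g n ≤ _ := h3
      _ = _ := by ring
  · have : g n ≤ g k + (k - r) ^ 2 * (1 / δ ^ 2) := by
      rcases le_or_gt n k with h | h
      · exact (hg h).trans (le_add_of_nonneg_right (by positivity))
      · have hk : (k : ℝ) < n := by exact_mod_cast h
        have : 1 ≤ (k - r) ^ 2 * (1 / δ ^ 2) := by
          rw [mul_one_div, le_div_iff₀ (by positivity), one_mul, ← neg_sub, neg_sq]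
          exact pow_le_pow_left₀ hδ.le (by linarith) 2
        linarith [hg1 n, hg0 k]
    calc _ ≤ poissonWeight r k * (g k + (k - r) ^ 2 * (1 / δ ^ 2)) :=
          mul_le_mul_of_nonneg_left this (poissonWeight_nonneg hr k)
      _ = _ := by ring

/-- The counterpart of `le_poisson_mean_add` for `n` above the mean. The `+ 1` in the hypothesis is
there because only the integers `k ≥ n + 1` have to be at distance `δ` from `r`; it accommodates
`n = ⌊r + δ⌋`. -/
theorem poisson_mean_le_add {g : ℕ → ℝ} (hg : Monotone g) (hg0 : ∀ n, 0 ≤ g n)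
    (hg1 : ∀ n, g n ≤ 1) {r δ F : ℝ} (hr : 0 ≤ r) (hδ : 0 < δ)
    (hF : HasSum (fun n => poissonWeight r n * g n) F) {n : ℕ} (hn : r + δ ≤ n + 1) :
    F ≤ g n + r / δ ^ 2 := by
  have h1 := ((hasSum_poissonWeight hr).mul_right (g n)).add
    ((hasSum_poissonWeight_variance hr).mul_right (1 / δ ^ 2))
  have h3 := hasSum_le (fun k => ?_) hF h1
  · rw [one_mul] at h3
    calc F ≤ _ := h3
      _ = _ := by ring
  · have : g k ≤ g n + (k - r) ^ 2 * (1 / δ ^ 2) := by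
      rcases le_or_gt k n with h | h
      · exact (hg h).trans (le_add_of_nonneg_right (by positivity))
      · have hk : (n : ℝ) + 1 ≤ k := by exact_mod_cast h
        have : 1 ≤ (k - r) ^ 2 * (1 / δ ^ 2) := by
          rw [mul_one_div, le_div_iff₀ (by positivity), one_mul]
          exact pow_le_pow_left₀ hδ.le (by linarith) 2
        linarith [hg1 k, hg0 n]
    calc _ ≤ poissonWeight r k * (g n + (k - r) ^ 2 * (1 / δ ^ 2)) :=
          mul_le_mul_of_nonneg_left this (poissonWeight_nonneg hr k)
      _ = _ := by ring

/-! ### Finite and infinite products -/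

/-- The product of the first `N` factors of `limitF`: the distribution function of the completion
time when the coupons of type `j < N` arrive as independent Poisson processes of rates `a j`. -/
noncomputable def finiteF (a : ℕ → ℝ) (m N : ℕ) (s : ℝ) : ℝ :=
  ∏ j ∈ Finset.range N, (1 - erlangTail m (a j * s))

theorem one_sub_erlangTail_mem (m : ℕ) {y : ℝ} (hy : 0 ≤ y) :
    0 ≤ 1 - erlangTail m y ∧ 1 - erlangTail m y ≤ 1 := by
  constructor <;> linarith [erlangTail_nonneg m hy, erlangTail_le_one m hy]

@[fun_prop]
theorem continuous_finiteF (a : ℕ → ℝ) (m N : ℕ) : Continuous (finiteF a m N) := by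
  unfold finiteF
  fun_prop

theorem prod_sub_sum_le_prod {ι : Type*} (s : Finset ι) {u v : ι → ℝ}
    (hv : ∀ i ∈ s, 0 ≤ v i) (hvu : ∀ i ∈ s, v i ≤ u i) (hu : ∀ i ∈ s, u i ≤ 1) :
    ∏ i ∈ s, (1 - v i) - ∑ i ∈ s, (u i - v i) ≤ ∏ i ∈ s, (1 - u i) := by
  classical
  induction s using Finset.induction_on with
  | empty => simp
  | insert i s hi ih =>
    simp only [Finset.forall_mem_insert] at hv hvu hu
    have ih' := ih hv.2 hvu.2 hu.2
    rw [Finset.prod_insert hi, Finset.prod_insert hi, Finset.sum_insert hi]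
    have hV0 : 0 ≤ ∏ j ∈ s, (1 - v j) := Finset.prod_nonneg fun j hj => by
      linarith [hvu.2 j hj, hu.2 j hj]
    have hV1 : ∏ j ∈ s, (1 - v j) ≤ 1 := Finset.prod_le_one
      (fun j hj => by linarith [hvu.2 j hj, hu.2 j hj]) (fun j hj => by linarith [hv.2 j hj])
    have hS : 0 ≤ ∑ j ∈ s, (u j - v j) :=
      Finset.sum_nonneg fun j hj => sub_nonneg.2 (hvu.2 j hj)
    have h1 := mul_le_mul_of_nonneg_left ih' (sub_nonneg.2 hu.1)
    have h2 : (u i - v i) * ∏ j ∈ s, (1 - v j) ≤ (u i - v i) * 1 :=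
      mul_le_mul_of_nonneg_left hV1 (sub_nonneg.2 hvu.1)
    have h3 : 0 ≤ u i * ∑ j ∈ s, (u j - v j) := mul_nonneg (hv.1.trans hvu.1) hS
    nlinarith

section

variable {a : ℕ → ℝ} {m : ℕ}

theorem tendsto_finiteF (ha : ∀ j, 0 < a j) {s : ℝ} (hs : 0 ≤ s) :
    Tendsto (fun N => finiteF a m N s) atTop (𝓝 (limitF a m s)) :=
  (multipliable_limitF ha m hs).hasProd.tendsto_prod_nat

theorem finiteF_antitone (ha : ∀ j, 0 < a j) {s : ℝ} (hs : 0 ≤ s) :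
    Antitone fun N => finiteF a m N s := by
  refine antitone_nat_of_succ_le fun N => ?_
  have h := one_sub_erlangTail_mem m (mul_nonneg (ha N).le hs)
  rw [finiteF, Finset.prod_range_succ]
  exact mul_le_of_le_one_right (Finset.prod_nonneg fun j _ =>
    (one_sub_erlangTail_mem m (mul_nonneg (ha j).le hs)).1) h.2

theorem limitF_le_finiteF (ha : ∀ j, 0 < a j) {s : ℝ} (hs : 0 ≤ s) (N : ℕ) :
    limitF a m s ≤ finiteF a m N s :=
  (finiteF_antitone ha hs).le_of_tendsto (tendsto_finiteF ha hs) N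

theorem limitF_nonneg (ha : ∀ j, 0 < a j) {s : ℝ} (hs : 0 ≤ s) : 0 ≤ limitF a m s :=
  ge_of_tendsto' (tendsto_finiteF ha hs) fun _ => Finset.prod_nonneg fun j _ =>
    (one_sub_erlangTail_mem m (mul_nonneg (ha j).le hs)).1

theorem limitF_le_one (ha : ∀ j, 0 < a j) {s : ℝ} (hs : 0 ≤ s) : limitF a m s ≤ 1 := by
  simpa [finiteF] using limitF_le_finiteF (m := m) ha hs 0

theorem limitF_zero (ha : ∀ j, 0 < a j) (hm : 1 ≤ m) : limitF a m 0 = 0 := by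
  refine le_antisymm ?_ (limitF_nonneg ha le_rfl)
  simpa [finiteF, erlangTail_zero_right hm] using limitF_le_finiteF (m := m) ha le_rfl 1

theorem finiteF_le_finiteF (hm : 1 ≤ m) {b : ℕ → ℝ} {s t : ℝ} (N : ℕ)
    (h0 : ∀ j, 0 ≤ a j * s) (h : ∀ j, a j * s ≤ b j * t) :
    finiteF a m N s ≤ finiteF b m N t :=
  Finset.prod_le_prod (fun j _ => (one_sub_erlangTail_mem m (h0 j)).1) fun j _ =>
    sub_le_sub_left (erlangTail_anti hm (h0 j) (h j)) 1

theorem limitF_mono (ha : ∀ j, 0 < a j) (hm : 1 ≤ m) {s t : ℝ} (hs : 0 ≤ s) (hst : s ≤ t) :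
    limitF a m s ≤ limitF a m t :=
  le_of_tendsto_of_tendsto' (tendsto_finiteF ha hs) (tendsto_finiteF ha (hs.trans hst)) fun N =>
    finiteF_le_finiteF hm N (fun j => mul_nonneg (ha j).le hs) fun j =>
      mul_le_mul_of_nonneg_left hst (ha j).le

theorem limitF_mono_left (ha : ∀ j, 0 < a j) (hm : 1 ≤ m) {b : ℕ → ℝ} (hab : ∀ j, a j ≤ b j)
    {s : ℝ} (hs : 0 ≤ s) : limitF a m s ≤ limitF b m s :=
  le_of_tendsto_of_tendsto' (tendsto_finiteF ha hs)
    (tendsto_finiteF (fun j => (ha j).trans_le (hab j)) hs) fun N =>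
    finiteF_le_finiteF hm N (fun j => mul_nonneg (ha j).le hs) fun j =>
      mul_le_mul_of_nonneg_right (hab j) hs

theorem summable_erlangTail (ha : ∀ j, 0 < a j) {s : ℝ} (hs : 0 ≤ s) (hF : 0 < limitF a m s) :
    Summable fun j => erlangTail m (a j * s) := by
  refine summable_of_sum_range_le (c := -Real.log (limitF a m s))
    (fun j => erlangTail_nonneg m (mul_nonneg (ha j).le hs)) fun N => ?_
  have h1 : limitF a m s ≤ Real.exp (-∑ j ∈ Finset.range N, erlangTail m (a j * s)) := by
    rw [← Finset.sum_neg_distrib, Real.exp_sum]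
    refine (limitF_le_finiteF ha hs N).trans (Finset.prod_le_prod (fun j _ =>
      (one_sub_erlangTail_mem m (mul_nonneg (ha j).le hs)).1) fun j _ => ?_)
    exact Real.one_sub_le_exp_neg _
  have h2 := Real.log_le_log hF h1
  rw [Real.log_exp] at h2
  linarith

/-- The union bound for the limit product. -/
theorem one_sub_tsum_le_limitF (ha : ∀ j, 0 < a j) {s : ℝ} (hs : 0 ≤ s)
    (hsum : Summable fun j => erlangTail m (a j * s)) :
    1 - ∑' j, erlangTail m (a j * s) ≤ limitF a m s := by
  refine le_of_tendsto_of_tendsto' (hsum.hasSum.tendsto_sum_nat.const_sub 1)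
    (tendsto_finiteF ha hs) fun N => ?_
  have h := prod_sub_sum_le_prod (Finset.range N) (u := fun j => erlangTail m (a j * s))
    (v := fun _ => 0) (fun _ _ => le_rfl)
    (fun j _ => erlangTail_nonneg m (mul_nonneg (ha j).le hs))
    (fun j _ => erlangTail_le_one m (mul_nonneg (ha j).le hs))
  simpa [finiteF] using h

theorem tendsto_limitF_atTop (ha : ∀ j, 0 < a j) (hm : 1 ≤ m) {s₀ : ℝ} (hs₀ : 0 ≤ s₀)
    (hF : 0 < limitF a m s₀) : Tendsto (limitF a m) atTop (𝓝 1) := by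
  have hsum := summable_erlangTail ha hs₀ hF
  have hbd : ∀ {t}, s₀ ≤ t → ∀ j, ‖erlangTail m (a j * t)‖ ≤ erlangTail m (a j * s₀) := by
    intro t ht j
    rw [Real.norm_of_nonneg (erlangTail_nonneg m (mul_nonneg (ha j).le (hs₀.trans ht)))]
    exact erlangTail_anti hm (mul_nonneg (ha j).le hs₀) (mul_le_mul_of_nonneg_left ht (ha j).le)
  have h : Tendsto (fun t => ∑' j, erlangTail m (a j * t)) atTop (𝓝 (∑' _ : ℕ, (0 : ℝ))) := by
    refine tendsto_tsum_of_dominated_convergence hsum (fun j => ?_)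
      ((eventually_ge_atTop s₀).mono fun t ht => hbd ht)
    exact (tendsto_erlangTail_atTop m).comp (tendsto_id.const_mul_atTop (ha j))
  rw [tsum_zero] at h
  refine tendsto_of_tendsto_of_tendsto_of_le_of_le' (by simpa using h.const_sub 1)
    tendsto_const_nhds ?_ ?_
  · filter_upwards [eventually_ge_atTop s₀] with t ht
    exact one_sub_tsum_le_limitF ha (hs₀.trans ht) (hsum.of_norm_bounded (hbd ht))
  · filter_upwards [eventually_ge_atTop s₀] with t ht
    exact limitF_le_one ha (hs₀.trans ht)

theorem tendsto_partialTotal (ha : ∀ j, 0 < a j) (hm : 1 ≤ m) {s₀ : ℝ} (hs₀ : 0 ≤ s₀)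
    (hF : 0 < limitF a m s₀) : Tendsto (partialTotal a) atTop atTop := by
  refine (not_summable_iff_tendsto_nat_atTop_of_nonneg fun j => (ha j).le).1 fun hsum => ?_
  have h1 : Tendsto (fun j => erlangTail m (a j * s₀)) atTop (𝓝 (erlangTail m (0 * s₀))) :=
    ((continuous_erlangTail m).tendsto _).comp (hsum.tendsto_atTop_zero.mul_const s₀)
  have h2 := tendsto_nhds_unique h1 (summable_erlangTail ha hs₀ hF).tendsto_atTop_zero
  rw [zero_mul, erlangTail_zero_right hm] at h2
  exact one_ne_zero h2

/-- Upper semicontinuity of `limitF`, in the sharper form that one finite product already stays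
below `c` near `s`. -/
theorem eventually_finiteF_lt (ha : ∀ j, 0 < a j) {s c : ℝ} (hs : 0 ≤ s)
    (hc : limitF a m s < c) : ∃ N, ∀ᶠ t in 𝓝 s, finiteF a m N t < c := by
  obtain ⟨N, hN⟩ := ((tendsto_finiteF ha hs).eventually_lt_const hc).exists
  exact ⟨N, (continuous_finiteF a m N).continuousAt.eventually_lt_const hN⟩

theorem continuousWithinAt_limitF (ha : ∀ j, 0 < a j) (hm : 1 ≤ m) {s : ℝ} (hs : 0 ≤ s) :
    ContinuousWithinAt (limitF a m) (Ici s) s := by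
  refine tendsto_order.2 ⟨fun c hc => ?_, fun c hc => ?_⟩
  · filter_upwards [self_mem_nhdsWithin] with t ht
    exact hc.trans_le (limitF_mono ha hm hs ht)
  · obtain ⟨N, hN⟩ := eventually_finiteF_lt ha hs hc
    filter_upwards [self_mem_nhdsWithin, nhdsWithin_le_nhds hN] with t ht ht'
    exact (limitF_le_finiteF ha (hs.trans ht) N).trans_lt ht'

/-- Lower bound for the finite products at times slightly before `s`, on the scale
`1 / B N = A_N^{-1/3}`. It holds also where `limitF` is not left-continuous, since the window shrinks
fast enough compared with the growth of `A_N`. -/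
theorem eventually_lt_finiteF_sub (ha : ∀ j, 0 < a j) (hm : 1 ≤ m) {s c : ℝ} (hs : 0 < s)
    (hc : c < limitF a m s) {B : ℕ → ℝ} (hB : Tendsto B atTop atTop)
    (hAB : ∀ N, B N ^ 3 = partialTotal a N) :
    ∀ᶠ N in atTop, c < finiteF a m N (s - 1 / B N) := by
  rcases (limitF_nonneg (m := m) ha hs.le).eq_or_lt with hF | hF
  · have hev : ∀ᶠ N in atTop, 1 / B N < s :=
      (tendsto_const_nhds.div_atTop hB).eventually_lt_const hs
    filter_upwards [hev] with N hN
    rw [← hF] at hc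
    exact hc.trans_le (Finset.prod_nonneg fun j _ => (one_sub_erlangTail_mem m
      (mul_nonneg (ha j).le (by linarith))).1)
  have hsum := summable_erlangTail ha hs.le hF
  obtain ⟨C, hC, hCφ⟩ := exists_erlangTail_le 3 m
  let K : ℝ := C / (s / 2) ^ 3
  have hK : 0 < K := by positivity
  let f : ℕ → ℕ → ℝ := fun N j =>
    (Real.exp (min (a j * (1 / B N)) 1) - 1) * erlangTail m (a j * s)
  have hε : Tendsto (fun N => 1 / B N) atTop (𝓝 0) := tendsto_const_nhds.div_atTop hB
  have hφ : ∀ j, 0 ≤ erlangTail m (a j * s) := fun j =>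
    erlangTail_nonneg m (mul_nonneg (ha j).le hs.le)
  have hf0 : ∀ {N}, 0 < B N → ∀ j, 0 ≤ f N j := by
    intro N hN j
    have : 0 ≤ min (a j * (1 / B N)) 1 :=
      le_min (mul_nonneg (ha j).le (by positivity)) zero_le_one
    exact mul_nonneg (sub_nonneg.2 (Real.one_le_exp this)) (hφ j)
  have hfb : ∀ {N}, 0 < B N → ∀ j, ‖f N j‖ ≤ (Real.exp 1 - 1) * erlangTail m (a j * s) := by
    intro N hN j
    rw [Real.norm_of_nonneg (hf0 hN j)]
    have := Real.exp_le_exp.2 (min_le_right (a j * (1 / B N)) 1)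
    exact mul_le_mul_of_nonneg_right (by linarith) (hφ j)
  have hBpos : ∀ᶠ N in atTop, 0 < B N := hB.eventually_gt_atTop 0
  have hf : Tendsto (fun N => ∑' j, f N j) atTop (𝓝 (∑' _ : ℕ, (0 : ℝ))) := by
    refine tendsto_tsum_of_dominated_convergence (hsum.mul_left (Real.exp 1 - 1)) (fun j => ?_)
      (hBpos.mono fun N hN => hfb hN)
    have h1 : Tendsto (fun N => min (a j * (1 / B N)) 1) atTop (𝓝 (min (a j * 0) 1)) :=
      (hε.const_mul _).min tendsto_const_nhds
    have h2 := ((Real.continuous_exp.tendsto _).comp h1).sub_const 1 |>.mul_const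
      (erlangTail m (a j * s))
    simpa [f] using h2
  have hD : Tendsto (fun N => limitF a m s - ((∑' j, f N j) + K * (1 / B N))) atTop
      (𝓝 (limitF a m s)) := by
    simpa using (hf.add (hε.const_mul K)).const_sub (limitF a m s)
  filter_upwards [hD.eventually_const_lt hc, hBpos,
    hε.eventually_lt_const (half_pos hs)] with N h1 hN h2
  refine h1.trans_le ?_
  have hε0 : 0 < 1 / B N := by positivity
  have hsub : ∀ j, a j * (s - 1 / B N) = a j * s - a j * (1 / B N) := fun j => mul_sub _ _ _
  have h0 : ∀ j, 0 ≤ a j * (s - 1 / B N) := fun j => mul_nonneg (ha j).le (by linarith)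
  have hterm : ∀ j, erlangTail m (a j * (s - 1 / B N)) - erlangTail m (a j * s) ≤
      f N j + K * (1 / B N) ^ 4 * a j := by
    intro j
    rcases le_total (a j * (1 / B N)) 1 with hj | hj
    -- here the mean changes by at most `1`, so the increment is a bounded multiple of the tail
    · have h3 := erlangTail_sub_le m (mul_nonneg (ha j).le hε0.le)
        (mul_le_mul_of_nonneg_left (by linarith : 1 / B N ≤ s) (ha j).le)
      have h4 : 0 ≤ K * (1 / B N) ^ 4 * a j := by have := ha j; positivity
      simp only [f, min_eq_left hj]
      rw [hsub]
      linarith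
    -- here `a j ≥ B N`, and the cubic decay of the tail costs at most `K * a j / (B N) ^ 4`
    · have h3 : erlangTail m (a j * (s - 1 / B N)) ≤ erlangTail m (a j * (s / 2)) :=
        erlangTail_anti hm (by have := ha j; positivity)
          (mul_le_mul_of_nonneg_left (by linarith) (ha j).le)
      have h4 := hCφ (a j * (s / 2)) (by have := ha j; positivity)
      have h5 : C / (a j * (s / 2)) ^ 3 ≤ K * (1 / B N) ^ 4 * a j := by
        have h6 : C / (a j * (s / 2)) ^ 3 = K * (1 / a j ^ 3) := by
          simp only [K]; rw [mul_pow]; field_simp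
        have haj := ha j
        rw [h6, mul_assoc]
        refine mul_le_mul_of_nonneg_left ?_ hK.le
        rw [div_le_iff₀ (by positivity)]
        calc (1 : ℝ) ≤ (a j * (1 / B N)) ^ 4 := one_le_pow₀ hj
          _ = _ := by ring
      linarith [hf0 hN j, hφ j]
  have hsumle : ∑ j ∈ Finset.range N, (erlangTail m (a j * (s - 1 / B N)) -
      erlangTail m (a j * s)) ≤ (∑' j, f N j) + K * (1 / B N) := by
    refine (Finset.sum_le_sum fun j _ => hterm j).trans ?_
    rw [Finset.sum_add_distrib, ← Finset.mul_sum]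
    have h3 : ∑ j ∈ Finset.range N, f N j ≤ ∑' j, f N j :=
      ((hsum.mul_left (Real.exp 1 - 1)).of_norm_bounded (hfb hN)).sum_le_tsum _
        fun j _ => hf0 hN j
    have h4 : K * (1 / B N) ^ 4 * ∑ j ∈ Finset.range N, a j = K * (1 / B N) := by
      have : ∑ j ∈ Finset.range N, a j = B N ^ 3 := (hAB N).symm
      rw [this]
      field_simp
    linarith
  have hprod := prod_sub_sum_le_prod (Finset.range N)
    (u := fun j => erlangTail m (a j * (s - 1 / B N))) (v := fun j => erlangTail m (a j * s))
    (fun j _ => hφ j)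
    (fun j _ => erlangTail_anti hm (h0 j) (mul_le_mul_of_nonneg_left (by linarith) (ha j).le))
    (fun j _ => erlangTail_le_one m (h0 j))
  have h5 := limitF_le_finiteF (m := m) ha hs.le N
  simp only [finiteF] at h5 ⊢
  linarith

/-- The integrand of `L₁` expressed by `F` through `s = -log x`. -/
theorem L1_eq (a : ℕ → ℝ) (m : ℕ) : L1 a m = ∫⁻ x in Ioo (0 : ℝ) 1,
    ENNReal.ofReal ((1 - limitF a m (-Real.log x)) / x) := by
  refine setLIntegral_congr_fun measurableSet_Ioo fun x hx => ?_
  rw [limitF]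
  congr 4 with j
  rw [Real.rpow_def_of_pos hx.1, mul_comm (Real.exp _)]
  ring_nf

/-- If `F` vanished on `(0, ∞)`, then `L₁` would be `∫₀¹ dx / x = ∞`. -/
theorem exists_limitF_pos (ha : ∀ j, 0 < a j) (hL : L1 a m < ∞) :
    ∃ s, 0 < s ∧ 0 < limitF a m s := by
  by_contra! hcon
  have h0 : ∀ s, 0 < s → limitF a m s = 0 := fun s hs =>
    le_antisymm (hcon s hs) (limitF_nonneg ha hs.le)
  have h1 : L1 a m = ∫⁻ x in Ioo (0 : ℝ) 1, ENNReal.ofReal (x ^ (-1 : ℝ)) := by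
    rw [L1_eq]
    refine setLIntegral_congr_fun measurableSet_Ioo fun x hx => ?_
    rw [h0 _ (neg_pos.2 (Real.log_neg hx.1 hx.2)), Real.rpow_neg_one, sub_zero, one_div]
  have h2 : IntegrableOn (fun x : ℝ => x ^ (-1 : ℝ)) (Ioo 0 1) := by
    refine ⟨by fun_prop, ?_⟩
    rw [hasFiniteIntegral_iff_ofReal, ← h1]
    · exact hL
    · filter_upwards [ae_restrict_mem measurableSet_Ioo] with x hx
      exact Real.rpow_nonneg hx.1.le _
  rw [intervalIntegral.integrableOn_Ioo_rpow_iff zero_lt_one] at h2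
  exact lt_irrefl _ h2

theorem L1_anti (ha : ∀ j, 0 < a j) (hm : 1 ≤ m) {b : ℕ → ℝ} (hab : ∀ j, a j ≤ b j) :
    L1 b m ≤ L1 a m := by
  rw [L1_eq, L1_eq]
  refine setLIntegral_mono' measurableSet_Ioo fun x hx => ENNReal.ofReal_le_ofReal ?_
  have := limitF_mono_left ha hm hab (neg_nonneg.2 (Real.log_neg hx.1 hx.2).le)
  exact div_le_div_of_nonneg_right (by linarith) hx.1.le

end

/-! ### Completion time and convergence in law -/

theorem couponCount_mono {Ω : Type*} {N : ℕ} (X : ℕ → Ω → Fin N) (i : Fin N) (ω : Ω) :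
    Monotone fun n => couponCount X n i ω := fun _ _ h =>
  Finset.card_le_card (Finset.filter_subset_filter _ (Finset.range_mono h))

theorem collectTime_le_iff {Ω : Type*} {N : ℕ} (m : ℕ) (X : ℕ → Ω → Fin N) (ω : Ω) (n : ℕ) :
    collectTime m X ω ≤ n ↔ ∀ i, m ≤ couponCount X n i ω := by
  refine ⟨fun h i => ?_, fun h => iInf₂_le n h⟩
  -- a strict bound on an infimum produces a witness, so the non-strict one is shifted by `1`
  have h' : collectTime m X ω < ((n + 1 : ℕ) : ℕ∞) :=
    h.trans_lt (by exact_mod_cast Nat.lt_succ_self n)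
  simp only [collectTime, iInf_lt_iff] at h'
  obtain ⟨k, hk, hkn⟩ := h'
  have hkn' : k ≤ n := Nat.lt_succ_iff.1 (by exact_mod_cast hkn)
  exact (hk i).trans (couponCount_mono X i ω hkn')

theorem collectTime_div_le_iff {Ω : Type*} {N : ℕ} (m : ℕ) (X : ℕ → Ω → Fin N) (ω : Ω)
    {A s : ℝ} (hA : 0 < A) (hs : 0 ≤ s) :
    (collectTime m X ω : ℝ≥0∞) / ENNReal.ofReal A ≤ ENNReal.ofReal s ↔
      ∀ i, m ≤ couponCount X ⌊s * A⌋₊ i ω := by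
  rw [← collectTime_le_iff, ENNReal.div_le_iff (by simpa using hA) ENNReal.ofReal_ne_top,
    ← ENNReal.ofReal_mul hs]
  induction collectTime m X ω using ENat.recTopCoe with
  | top => simp
  | coe k =>
    rw [ENat.toENNReal_coe, ← ENNReal.ofReal_natCast, ENNReal.ofReal_le_ofReal_iff
      (by positivity), Nat.cast_le, Nat.le_floor_iff (by positivity)]

/-- Poissonization: averaging the probability that `n` draws complete the collection over a Poisson
number `n` of draws with mean `t A_N` gives the finite product at time `t`. -/
theorem hasSum_poissonWeight_mul_collected {Ω : Type*} [MeasurableSpace Ω] {a : ℕ → ℝ}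
    (ha : ∀ j, 0 < a j) {N : ℕ} (hA : 0 < partialTotal a N) {P : Measure Ω}
    {X : ℕ → Ω → Fin N} (hX : IsCouponDraws P (couponProb a N) X) (m : ℕ) {t : ℝ} (ht : 0 ≤ t) :
    HasSum (fun n => poissonWeight (t * partialTotal a N) n *
      P.real {ω | ∀ i, m ≤ couponCount X n i ω}) (finiteF a m N t) := by
  have h := hasSum_poisson_multinomial (p := couponProb a N)
    (fun j => div_nonneg (ha j).le hA.le)
    (by
      simp only [couponProb]
      rw [← Finset.sum_div, Fin.sum_univ_eq_sum_range, ← partialTotal, div_self hA.ne'])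
    (mul_nonneg ht hA.le) m
  have hF : finiteF a m N t = ∏ j : Fin N, (1 - expPartialSum m
      (couponProb a N j * (t * partialTotal a N)) *
        Real.exp (-(couponProb a N j * (t * partialTotal a N)))) := by
    rw [finiteF, ← Fin.prod_univ_eq_prod_range (fun j => 1 - erlangTail m (a j * t))]
    refine Finset.prod_congr rfl fun j _ => ?_
    have : couponProb a N j * (t * partialTotal a N) = a j * t := by
      rw [couponProb]; field_simp
    rw [this, erlangTail]
  rw [hF]
  have e : ∀ n, P.real {ω | ∀ i, m ≤ couponCount X n i ω} = _ := fun n =>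
    measureReal_couponCount_mem hX n {k | ∀ j, m ≤ k j}
  simp_rw [e]
  exact h

/-- Convergence in law of the completion time, at every `s > 0` (continuity point or not). -/
theorem tendsto_collected {a : ℕ → ℝ} (ha : ∀ j, 0 < a j) {m : ℕ} (hm : 1 ≤ m)
    (hA : Tendsto (partialTotal a) atTop atTop) {Ω : ℕ → Type*} [∀ N, MeasurableSpace (Ω N)]
    {P : ∀ N, Measure (Ω N)} {X : ∀ N, ℕ → Ω N → Fin N}
    (hX : ∀ N, 1 ≤ N → IsCouponDraws (P N) (couponProb a N) (X N)) {s : ℝ} (hs : 0 < s) :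
    Tendsto (fun N => (P N).real
      {ω | ∀ i, m ≤ couponCount (X N) ⌊s * partialTotal a N⌋₊ i ω}) atTop
      (𝓝 (limitF a m s)) := by
  -- The window `ε = 1 / B` with `B = A ^ (1 / 3)` is wide enough for Chebyshev's inequality, as
  -- `1 / (ε ^ 2 * A) = ε`, and narrow enough for `F_N (s - ε)` to stay close to `F_N s`.
  let B : ℕ → ℝ := fun N => partialTotal a N ^ (1 / 3 : ℝ)
  have hA0 : ∀ N, 0 ≤ partialTotal a N := fun N => Finset.sum_nonneg fun j _ => (ha j).le
  have hB : Tendsto B atTop atTop := (tendsto_rpow_atTop (by norm_num)).comp hA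
  have hAB : ∀ N, B N ^ 3 = partialTotal a N := fun N => by
    simp only [B]
    rw [← Real.rpow_natCast, ← Real.rpow_mul (hA0 N)]
    norm_num
  have hε : Tendsto (fun N => 1 / B N) atTop (𝓝 0) := tendsto_const_nhds.div_atTop hB
  have herr : ∀ {N t}, 0 < B N →
      t * partialTotal a N / (1 / B N * partialTotal a N) ^ 2 = t * (1 / B N) := by
    intro N t hN
    rw [← hAB]
    field_simp
  have hev : ∀ᶠ N in atTop, 1 ≤ N ∧ 0 < B N ∧ 1 / B N < s :=
    (eventually_ge_atTop 1).and ((hB.eventually_gt_atTop 0).and (hε.eventually_lt_const hs))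
  let g : ℕ → ℕ → ℝ := fun N n => (P N).real {ω | ∀ i, m ≤ couponCount (X N) n i ω}
  have hgm : ∀ {N}, 1 ≤ N → Monotone (g N) := by
    intro N hN k l hkl
    have := (hX N hN).isProbabilityMeasure
    exact measureReal_mono fun ω hω i => (hω i).trans (couponCount_mono _ i ω hkl)
  have hg1 : ∀ {N}, 1 ≤ N → ∀ n, g N n ≤ 1 := by
    intro N hN n
    have := (hX N hN).isProbabilityMeasure
    exact measureReal_le_one
  have hg0 : ∀ N n, 0 ≤ g N n := fun N n => measureReal_nonneg
  refine tendsto_order.2 ⟨fun c hc => ?_, fun c hc => ?_⟩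
  · obtain ⟨d, hcd, hd⟩ := exists_between hc
    have herr0 : Tendsto (fun N => (s - 1 / B N) * (1 / B N)) atTop (𝓝 0) := by
      simpa using (hε.const_sub s).mul hε
    filter_upwards [hev, eventually_lt_finiteF_sub ha hm hs hd hB hAB,
      herr0.eventually_lt_const (sub_pos.2 hcd)] with N ⟨hN, hBN, hBs⟩ h1 h2
    have hAN : 0 < partialTotal a N := by rw [← hAB]; positivity
    have ht : 0 ≤ s - 1 / B N := by linarith
    have h3 := poisson_mean_le_add (hgm hN) (hg0 N) (hg1 hN) (δ := 1 / B N * partialTotal a N)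
      (mul_nonneg ht hAN.le) (by positivity)
      (hasSum_poissonWeight_mul_collected ha hAN (hX N hN) m ht) (n := ⌊s * partialTotal a N⌋₊)
      (by
        have := (Nat.lt_floor_add_one (s * partialTotal a N)).le
        linarith)
    rw [herr hBN] at h3
    linarith
  · obtain ⟨d, hd, hdc⟩ := exists_between hc
    obtain ⟨M, hM⟩ := eventually_finiteF_lt ha hs.le hd
    have hsε : Tendsto (fun N => s + 1 / B N) atTop (𝓝 s) := by simpa using hε.const_add s
    have herr0 : Tendsto (fun N => (s + 1 / B N) * (1 / B N)) atTop (𝓝 0) := by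
      simpa using hsε.mul hε
    filter_upwards [hev, hsε.eventually hM, eventually_ge_atTop M,
      herr0.eventually_lt_const (sub_pos.2 hdc)] with N ⟨hN, hBN, hBs⟩ h1 hMN h2
    have hAN : 0 < partialTotal a N := by rw [← hAB]; positivity
    have ht : 0 ≤ s + 1 / B N := by positivity
    have h3 := le_poisson_mean_add (hgm hN) (hg0 N) (hg1 hN) (δ := 1 / B N * partialTotal a N)
      (mul_nonneg ht hAN.le) (by positivity)
      (hasSum_poissonWeight_mul_collected ha hAN (hX N hN) m ht) (n := ⌊s * partialTotal a N⌋₊)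
      (by
        have := Nat.floor_le (mul_nonneg hs.le hAN.le)
        linarith)
    rw [herr hBN] at h3
    have h4 := finiteF_antitone (m := m) ha ht hMN
    simp only at h4
    linarith

/-! ### Properties of the limit law -/

theorem exists_measure_limitF {a : ℕ → ℝ} (ha : ∀ j, 0 < a j) {m : ℕ} (hm : 1 ≤ m)
    {s₀ : ℝ} (hs₀ : 0 ≤ s₀) (hF : 0 < limitF a m s₀) :
    ∃ ν : Measure ℝ, IsProbabilityMeasure ν ∧
      ∀ s : ℝ, ν.real (Iic s) = limitF a m (max s 0) := by
  let F : StieltjesFunction ℝ :=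
    { toFun := fun s => limitF a m (max s 0)
      mono' := fun s t hst =>
        limitF_mono ha hm (le_max_right _ _) (max_le_max_right 0 hst)
      right_continuous' := fun s =>
        (continuousWithinAt_limitF ha hm (le_max_right s 0)).comp (f := fun t => max t 0)
          (continuous_id.max continuous_const).continuousWithinAt
          fun t ht => (max_le_max_right 0 (mem_Ici.1 ht) : max s 0 ≤ max t 0) }
  have hbot : Tendsto F atBot (𝓝 0) := by
    refine tendsto_const_nhds.congr' ?_
    filter_upwards [eventually_le_atBot 0] with s hs
    change 0 = limitF a m (max s 0)
    rw [max_eq_right hs, limitF_zero ha hm]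
  have htop : Tendsto F atTop (𝓝 1) :=
    (tendsto_limitF_atTop ha hm hs₀ hF).comp
      (tendsto_atTop_mono (fun s => le_max_left s 0) tendsto_id)
  refine ⟨F.measure, F.isProbabilityMeasure hbot htop, fun s => ?_⟩
  rw [measureReal_def, F.measure_Iic hbot, sub_zero, ENNReal.toReal_ofReal
    (limitF_nonneg ha (le_max_right s 0) : 0 ≤ F s)]

theorem limitF_eq_mul {a : ℕ → ℝ} (ha : ∀ j, 0 < a j) (m : ℕ) {s : ℝ} (hs : 0 ≤ s) :
    limitF a m s = (1 - erlangTail m (a 0 * s)) * limitF (fun j => a (j + 1)) m s :=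
  tprod_eq_zero_mul' (f := fun j => 1 - erlangTail m (a j * s))
    (multipliable_limitF (fun j => ha (j + 1)) m hs)

theorem limitF_update_zero_lt {a : ℕ → ℝ} (ha : ∀ j, 0 < a j) {m : ℕ} (hm : 1 ≤ m) {b : ℝ}
    (hb : a 0 < b) {s : ℝ} (hs : 0 < s) (hF : 0 < limitF a m s) :
    limitF a m s < limitF (Function.update a 0 b) m s := by
  have hb0 : 0 < b := (ha 0).trans hb
  have hup : ∀ j, 0 < Function.update a 0 b j := by
    intro j
    rcases eq_or_ne j 0 with rfl | hj
    · simpa using hb0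
    · simpa [hj] using ha j
  have htail : (fun j => Function.update a 0 b (j + 1)) = fun j => a (j + 1) := by
    funext j; simp
  rw [limitF_eq_mul ha m hs.le] at hF ⊢
  rw [limitF_eq_mul hup m hs.le, htail, Function.update_self]
  have hT : 0 < limitF (fun j => a (j + 1)) m s :=
    pos_of_mul_pos_right hF (one_sub_erlangTail_mem m (mul_nonneg (ha 0).le hs.le)).1
  refine mul_lt_mul_of_pos_right (sub_lt_sub_left ?_ 1) hT
  exact strictAntiOn_erlangTail hm (mul_nonneg (ha 0).le hs.le) (mul_nonneg hb0.le hs.le)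
    (mul_lt_mul_of_pos_right hb hs)

theorem theorem4p1 (a : ℕ → ℝ) (ha : ∀ j, 0 < a j) (m : ℕ) (hm : 1 ≤ m) (hL : L1 a m < ∞)
    {Ω : ℕ → Type*} [∀ N, MeasurableSpace (Ω N)] (P : ∀ N, Measure (Ω N))
    (X : ∀ N, ℕ → Ω N → Fin N)
    (hX : ∀ N, 1 ≤ N → IsCouponDraws (P N) (couponProb a N) (X N)) :
    (∀ s : ℝ, 0 ≤ s →
      Tendsto
        (fun N => (P N).real
          {ω | (collectTime m (X N) ω : ℝ≥0∞) / ENNReal.ofReal (partialTotal a N)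
            ≤ ENNReal.ofReal s})
        atTop (𝓝 (limitF a m s))) ∧
    (∃ ν : Measure ℝ, IsProbabilityMeasure ν ∧
      (∀ s : ℝ, 0 ≤ s → ν.real (Iic s) = limitF a m s) ∧
      ∀ b c : ℝ, 0 < c → ∃ x : ℝ, ν.real (Iic x) ≠ gumbelCDF b c x) ∧
    (∃ a' : ℕ → ℝ, (∀ j, 0 < a' j) ∧ L1 a' m < ∞ ∧
      ∃ s : ℝ, 0 ≤ s ∧ limitF a' m s ≠ limitF a m s) := by
  obtain ⟨s₀, hs₀, hF⟩ := exists_limitF_pos ha hL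
  refine ⟨fun s hs => ?_, ?_, ?_⟩
  · have hev : ∀ᶠ N in atTop, (P N).real
        {ω | ∀ i, m ≤ couponCount (X N) ⌊s * partialTotal a N⌋₊ i ω} = (P N).real
          {ω | (collectTime m (X N) ω : ℝ≥0∞) / ENNReal.ofReal (partialTotal a N)
            ≤ ENNReal.ofReal s} := by
      filter_upwards [eventually_ge_atTop 1] with N hN
      have hA : 0 < partialTotal a N :=
        Finset.sum_pos (fun j _ => ha j) (Finset.nonempty_range_iff.2 (by omega))
      simp_rw [collectTime_div_le_iff m (X N) _ hA hs]
    refine Tendsto.congr' hev ?_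
    rcases hs.eq_or_lt with rfl | hs
    · rw [limitF_zero ha hm]
      refine tendsto_const_nhds.congr' ?_
      filter_upwards [eventually_ge_atTop 1] with N hN
      have hempty : {ω | ∀ i, m ≤ couponCount (X N) ⌊0 * partialTotal a N⌋₊ i ω} = ∅ := by
        refine eq_empty_of_forall_notMem fun ω hω => ?_
        have h := hω ⟨0, hN⟩
        simp only [zero_mul, Nat.floor_zero, couponCount, Finset.range_zero,
          Finset.filter_empty, Finset.card_empty] at h
        omega
      rw [hempty, measureReal_empty]
    · exact tendsto_collected ha hm (tendsto_partialTotal ha hm hs₀.le hF) hX hs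
  · obtain ⟨ν, hν, hνF⟩ := exists_measure_limitF ha hm hs₀.le hF
    refine ⟨ν, hν, fun s hs => by rw [hνF, max_eq_left hs], fun b c _ => ⟨0, ?_⟩⟩
    rw [hνF, max_self, limitF_zero ha hm]
    exact (Real.exp_pos _).ne
  · have hle : ∀ j, a j ≤ Function.update a 0 (2 * a 0) j := by
      intro j
      rcases eq_or_ne j 0 with rfl | hj
      · simp only [Function.update_self]
        linarith [ha 0]
      · rw [Function.update_of_ne hj]
    exact ⟨Function.update a 0 (2 * a 0), fun j => (ha j).trans_le (hle j),
      (L1_anti ha hm hle).trans_lt hL, s₀, hs₀.le,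
      (limitF_update_zero_lt ha hm (by linarith [ha 0]) hs₀ hF).ne'⟩
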